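/- A confounded structural causal model (SCM) $\mathcal M=(\mathbf f,P_{\mathbf u},P_{\mathbf z})$ over real observed variables $\mathbf x=(x_1,\dots,x_D)$ consists of structural equations $x_i=f_i(\mathbf x_{\mathrm{pa}(i)},u_i,\mathbf z)$, $i=1,\dots,D$, with exogenous variables $\mathbf u=(u_1,\dots,u_D)\sim P_{\mathbf u}$ and hidden confounders $\mathbf z\sim P_{\mathbf z}$ independent of $\mathbf u$. Its causal graph has an edge $x_j\to x_i$ (resp. $\mathbf z\to x_i$) exactly when $f_i$ really depends on $x_j$ (resp. on $\mathbf z$), and $\mathrm{ch}(\mathbf z)$ is the set of children of $\mathbf z$. Assume throughout that the $f_i$ are measurable, that the causal graph is acyclic, that $u_1,\dots,u_D$ are mutually independent, that $\mathbf u$ has a Lebesgue density and takes values in a product $\mathcal U=\prod_i U_i$ of open intervals, and that for every $\mathbf z$ the data-generating process $\mathbf u\mapsto\mathbf x$ obtained by solving the structural equations is a $C^1$-diffeomorphism from $\mathcal U$ onto a fixed open set $\mathcal X\subseteq\mathbb R^D$. Let $\mathcal M=(\mathbf f,P_{\mathbf u},P_{\mathbf z})$ and $\hat{\mathcal M}=(\hat{\mathbf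 f},P_{\hat{\mathbf u}},P_{\hat{\mathbf z}})$ be two such SCMs, with the same $\mathcal X$ (but possibly different $\mathcal U,\hat{\mathcal U}$ and different confounder spaces), that are Markov-equivalent, i.e. induce the same causal graph, and whose observational densities satisfy $p(\mathbf x)=\hat p(\mathbf x)$ for almost every $\mathbf x$. Then $\mathcal M$ and $\hat{\mathcal M}$, restricted to the variables outside $\mathrm{ch}(\mathbf z)$, are equal up to an invertible element-wise transformation of the exogenous distributions. That is, there are $C^1$-diffeomorphisms $T_i:U_i\to\hat U_i$, one for each $x_i\notin\mathrm{ch}(\mathbf z)$, such that, writing $\mathbf u^{\mathsf c}=(u_i)_{x_i\notin\mathrm{ch}(\mathbf z)}$ and $T(\mathbf u^{\mathsf c})=(T_i(u_i))_{x_i\notin\mathrm{ch}(\mathbf z)}$: 1. $T$ pushes the law of $\mathbf u^{\mathsf c}$ forward to the law of $\hat{\mathbf u}^{\mathsf c}$; 2. for almost every value $\mathbf c$ of $\mathrm{ch}(\mathbf z)$, $T$ pushes the conditional law of $\mathbf u^{\mathsf c}$ given $\mathrm{ch}(\mathbf z)=\mathbf c$ in $\mathcal M$ forward to the conditional law of $\hat{\mathbf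 u}^{\mathsf c}$ given $\mathrm{ch}(\mathbf z)=\mathbf c$ in $\hat{\mathcal M}$; 3. for every $x_i\notin\mathrm{ch}(\mathbf z)$, $P_{\mathbf x}$-almost every $\mathbf x$ and $P_{u_i}$-almost every $v$, $f_i(\mathbf x_{\mathrm{pa}(i)},v)=\hat f_i(\mathbf x_{\mathrm{pa}(i)},T_i(v))$ (neither side depends on the confounders). -/

import Mathlib

open MeasureTheory ProbabilityTheory Set

/-- A causal graph over the observed variables `ι` and one hidden (root) node `z`:
`edge j i` says that `x j` is a causal parent of `x i`, and `hiddenChildren` is `ch(z)`. -/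
structure CausalGraph (ι : Type*) where
  edge : ι → ι → Prop
  hiddenChildren : Set ι

/-- No directed cycles (`z` has no incoming edges, so it lies on none). -/
def CausalGraph.Acyclic {ι : Type*} (G : CausalGraph ι) : Prop :=
  ∀ i, ¬ Relation.TransGen G.edge i i

/-- A confounded structural causal model `(f, P_u, P_z)` with real-valued observed variables
`x i` and exogenous variables `u i ∈ U i`, `i : ι`, and hidden confounders `z : Z`.
The structural equations are `x i = f i x (u i) z`. Formally `f i` takes the whole vector `x`;
the coordinates on which it really depends are the causal parents, see `SCM.causalGraph`.
(If the equation makes sense only for some values of the parents, it is extended to a function of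
the same parents.) -/
structure SCM (ι : Type*) (Z : Type*) [MeasurableSpace Z] where
  U : ι → Set ℝ
  f : ι → (ι → ℝ) → ℝ → Z → ℝ
  Pu : Measure (ι → ℝ)
  Pz : Measure Z
  isProb_Pu : IsProbabilityMeasure Pu
  isProb_Pz : IsProbabilityMeasure Pz

attribute [instance] SCM.isProb_Pu SCM.isProb_Pz

/-- `T` restricts to a `C¹` diffeomorphism from the open set `A` onto the open set `B`. -/
def IsC1Diffeo {E : Type*} [NormedAddCommGroup E] [NormedSpace ℝ E]
    (T : E → E) (A B : Set E) : Prop :=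
  IsOpen A ∧ IsOpen B ∧ MapsTo T A B ∧ ContDiffOn ℝ 1 T A ∧
    ∃ R : E → E, MapsTo R B A ∧ ContDiffOn ℝ 1 R B ∧ InvOn R T A B

namespace SCM

variable {ι Z : Type*} [MeasurableSpace Z]

/-- The domain `𝒰 = ∏ i, U i` of the exogenous vector. -/
def box (M : SCM ι Z) : Set (ι → ℝ) := Set.univ.pi M.U

/-- The causal graph induced by a model: there is an edge exactly when the structural equation
really depends on the variable. -/
def causalGraph (M : SCM ι Z) : CausalGraph ι where
  edge j i := ∃ x y : ι → ℝ, (∀ k, k ≠ j → x k = y k) ∧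
    ∃ v ∈ M.U i, ∃ z, M.f i x v z ≠ M.f i y v z
  hiddenChildren := {i | ∃ x, ∃ v ∈ M.U i, ∃ z z', M.f i x v z ≠ M.f i x v z'}

/-- One simultaneous evaluation of all structural equations. -/
def step (M : SCM ι Z) (u : ι → ℝ) (z : Z) (x : ι → ℝ) : ι → ℝ :=
  fun i => M.f i x (u i) z

/-- The data-generating process `(u, z) ↦ x`: evaluate the structural equations as often as there
are variables. For an acyclic graph this is the unique solution of the structural equations,
see `SCM.eq_generate_iff`. -/
def generate [Fintype ι] (M : SCM ι Z) (u : ι → ℝ) (z : Z) : ι → ℝ :=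
  (M.step u z)^[Fintype.card ι] 0

theorem f_congr [Finite ι] (M : SCM ι Z) {i : ι} {v : ℝ} (hv : v ∈ M.U i) (z : Z)
    {x y : ι → ℝ} (h : ∀ j, M.causalGraph.edge j i → x j = y j) :
    M.f i x v z = M.f i y v z := by
  classical
  have := Fintype.ofFinite ι
  have key : ∀ s : Finset ι,
      M.f i (fun j => if j ∈ s then y j else x j) v z = M.f i x v z := by
    intro s
    induction s using Finset.induction_on with
    | empty => simp
    | insert a s ha ih =>
      rw [← ih]
      by_cases he : M.causalGraph.edge a i
      · congr 1
        funext j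
        by_cases hj : j = a
        · subst hj; simp [ha, h j he]
        · simp [hj]
      · by_contra hne
        exact he ⟨_, _, fun k hk => by simp [hk], v, hv, z, hne⟩
  have := key Finset.univ
  simpa using this.symm

theorem eq_generate_iff [Fintype ι] (M : SCM ι Z) (hM : M.causalGraph.Acyclic)
    {u : ι → ℝ} (hu : u ∈ M.box) (z : Z) (x : ι → ℝ) :
    x = M.generate u z ↔ ∀ i, x i = M.f i x (u i) z := by
  classical
  let anc : ι → Finset ι := fun i => {j | Relation.TransGen M.causalGraph.edge j i}
  have hlt : ∀ {i j}, M.causalGraph.edge j i → (anc j).card < (anc i).card := by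
    intro i j h
    refine Finset.card_lt_card ((Finset.ssubset_iff_of_subset ?_).2 ⟨j, ?_, ?_⟩)
    · intro k hk
      simp only [anc, Finset.mem_filter, Finset.mem_univ, true_and] at hk ⊢
      exact hk.tail h
    · simpa [anc] using Relation.TransGen.single h
    · simpa [anc] using hM j
  have htop : ∀ i, (anc i).card < Fintype.card ι := fun i =>
    Finset.card_lt_univ_of_notMem (x := i) (by simpa [anc] using hM i)
  have agree : ∀ (n : ℕ) (a b : ι → ℝ) (i : ι), (anc i).card < n →
      ((M.step u z)^[n] a) i = ((M.step u z)^[n] b) i := by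
    intro n
    induction n with
    | zero => intro a b i h; omega
    | succ n ih =>
      intro a b i h
      rw [Function.iterate_succ_apply', Function.iterate_succ_apply']
      exact M.f_congr (hu i (mem_univ i)) z fun j hj => ih a b j (by have := hlt hj; omega)
  have all : ∀ a b, (M.step u z)^[Fintype.card ι] a = (M.step u z)^[Fintype.card ι] b :=
    fun a b => funext fun i => agree _ a b i (htop i)
  constructor
  · rintro rfl i
    have : M.step u z (M.generate u z) = M.generate u z := by
      unfold generate
      rw [← Function.iterate_succ_apply' (M.step u z), Function.iterate_succ_apply]
      exact all _ _
    exact (congrFun this i).symm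
  · intro h
    have hfix : M.step u z x = x := funext fun i => (h i).symm
    unfold generate
    rw [all 0 x, Function.iterate_fixed hfix]

/-- The joint law of the (independent) pair `(u, z)`. -/
noncomputable def latentLaw (M : SCM ι Z) : Measure ((ι → ℝ) × Z) := M.Pu.prod M.Pz

instance (M : SCM ι Z) : IsProbabilityMeasure M.latentLaw := by
  unfold latentLaw; infer_instance

/-- The observational distribution of `x`. -/
noncomputable def obsLaw [Fintype ι] (M : SCM ι Z) : Measure (ι → ℝ) :=
  M.latentLaw.map fun p => M.generate p.1 p.2

/-- The observational density `p(x)` with respect to Lebesgue measure. -/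
noncomputable def obsDensity [Fintype ι] (M : SCM ι Z) : (ι → ℝ) → ENNReal :=
  M.obsLaw.rnDeriv volume

/-- The standing assumptions on a model whose observed vector takes values in `X`. -/
structure Admissible [Fintype ι] (M : SCM ι Z) (X : Set (ι → ℝ)) : Prop where
  /-- Exogenous variables live in open intervals (bounded or not). -/
  isOpen_U : ∀ i, IsOpen (M.U i)
  ordConnected_U : ∀ i, (M.U i).OrdConnected
  measurable_f : ∀ i, Measurable fun p : (ι → ℝ) × ℝ × Z => M.f i p.1 p.2.1 p.2.2
  /-- The exogenous vector lies in its domain, has a density, and independent entries. -/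
  mem_box : ∀ᵐ u ∂M.Pu, u ∈ M.box
  continuous_law : M.Pu ≪ volume
  indep : iIndepFun (fun (i : ι) (u : ι → ℝ) => u i) M.Pu
  acyclic : M.causalGraph.Acyclic
  /-- Given `z`, the data-generating process is a `C¹` diffeomorphism from `𝒰` onto `X`. -/
  diffeo : ∀ z, IsC1Diffeo (fun u => M.generate u z) M.box X

/-- The law of the exogenous variables outside `S`. -/
noncomputable def exoLaw (M : SCM ι Z) (S : Set ι) : Measure ({i // i ∉ S} → ℝ) :=
  M.Pu.map fun u i => u i

/-- The conditional law of the exogenous variables outside `S`, given that the observed variables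
in `S` take the value `c`. -/
noncomputable def condExoLaw [Fintype ι] (M : SCM ι Z) (S : Set ι) (c : S → ℝ) :
    Measure ({i // i ∉ S} → ℝ) :=
  condDistrib (fun (p : (ι → ℝ) × Z) (i : {i // i ∉ S}) => p.1 i)
    (fun (p : (ι → ℝ) × Z) (i : S) => M.generate p.1 p.2 i) M.latentLaw c

/-- The models `M` and `N`, restricted to the variables outside `S`, are equal up to the
element-wise transformation `T` of the exogenous variables. -/
structure EqOutsideUpTo {Z' : Type*} [MeasurableSpace Z'] [Fintype ι]
    (M : SCM ι Z) (N : SCM ι Z') (S : Set ι) (T : {i // i ∉ S} → ℝ → ℝ) : Prop where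
  /-- Each `T i` is invertible, and smooth in both directions. -/
  invertible : ∀ i, IsC1Diffeo (T i) (M.U i) (N.U i)
  /-- `T` transforms the exogenous distribution of `M` into that of `N`, -/
  exo : (M.exoLaw S).map (fun w i => T i (w i)) = N.exoLaw S
  /-- and so it does after conditioning on almost every value of the variables in `S`. -/
  condExo : ∀ᵐ c ∂(M.obsLaw.map fun x (i : S) => x i),
    (M.condExoLaw S c).map (fun w i => T i (w i)) = N.condExoLaw S c
  /-- The causal mechanisms coincide after transforming the exogenous variable, for almost every
  value of the observed variables (only the parents matter) and of the exogenous variable. -/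
  mechanism : ∀ i : {i // i ∉ S}, ∀ᵐ x ∂M.obsLaw, ∀ᵐ v ∂(M.Pu.map fun u => u i),
    ∀ z z', M.f i x v z = N.f i x (T i v) z'

end SCM

/-! Fix `i` outside `ch(z)`. The causal parents of `x i` are functions of `z` and of exogenous
entries other than `u i`, so they are independent of `u i`. The conditional law of `x i` given its
parents is therefore the push-forward of the law of `u i` under the mechanism `f i x · z`, and
equality of the observational laws makes these push-forwards agree in the two models for almost
every `x` (`ae_map_f_eq`).

Each mechanism is continuous and injective in the exogenous variable, hence strictly monotone, in a
direction that does not depend on `x` (`strictMonoOn_or_strictAntiOn_f`). At one good base point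
`x₀`, matching the values of the two mechanisms defines `T i`. It is smooth because it is a
coordinate of one data-generating process followed by the inverse of the other. At another good `x`,
the mechanism of `M` and that of `N` composed with `T i` are monotone in the same direction with the
same push-forward, so they agree almost everywhere.

Consequently `T i (u i)` is almost surely the exogenous value that `N` assigns to the same
observation, a function of `x` alone. Its joint law with the observed children of `z` then depends
only on the observational law, which gives both the marginal and the conditional claims. -/

theorem ContinuousOn.measurable_piecewise_zero {α β : Type*} [TopologicalSpace α]
    [MeasurableSpace α] [BorelSpace α] [TopologicalSpace β] [MeasurableSpace β] [BorelSpace β]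
    [Zero β] {s : Set α} [DecidablePred (· ∈ s)] {f : α → β} (hf : ContinuousOn f s)
    (hs : MeasurableSet s) : Measurable (s.piecewise f 0) := by
  refine measurable_of_restrict_of_restrict_compl hs ?_ ?_
  · rw [domRestrict_piecewise]
    exact hf.domRestrict.measurable
  · rw [domRestrict_piecewise_compl]
    exact measurable_const

/-! ### Push-forwards under monotone and injective maps; independence. -/

namespace MeasureTheory

/-- Strictly increasing continuous functions on an open conull set are determined almost everywhere
by the push-forward of a finite measure: one inequality. -/
theorem ae_le_of_map_eq_of_strictMonoOn {μ : Measure ℝ} [IsFiniteMeasure μ] {U : Set ℝ}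
    (hU : IsOpen U) (hμ : ∀ᵐ v ∂μ, v ∈ U) {A B : ℝ → ℝ} (hA : AEMeasurable A μ)
    (hB : AEMeasurable B μ) (hAm : StrictMonoOn A U) (hBm : StrictMonoOn B U)
    (hAc : ContinuousOn A U) (h : μ.map A = μ.map B) : ∀ᵐ v ∂μ, B v ≤ A v := by
  -- Both `Iic (A q)` and `Iic (B q)` have mass `μ (Iic q)` under the common push-forward, so the
  -- gap between them is null.
  have hnull : ∀ q ∈ U, A q < B q → ∀ᵐ v ∂μ, B v ∉ Ioc (A q) (B q) := by
    intro q hq hlt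
    have hIic : ∀ C : ℝ → ℝ, AEMeasurable C μ → StrictMonoOn C U →
        μ.map C (Iic (C q)) = μ (Iic q) := by
      intro C hC hCm
      rw [Measure.map_apply_of_aemeasurable hC measurableSet_Iic]
      refine measure_congr (Filter.eventuallyEq_set.2 ?_)
      filter_upwards [hμ] with v hv
      exact hCm.le_iff_le hv hq
    have hzero : μ.map B (Ioc (A q) (B q)) = 0 := by
      rw [← Iic_sdiff_Iic, measure_sdiff (Iic_subset_Iic.2 hlt.le)
        measurableSet_Iic.nullMeasurableSet (measure_ne_top _ _), hIic B hB hBm, ← h,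
        hIic A hA hAm, tsub_self]
    rw [Measure.map_apply_of_aemeasurable hB measurableSet_Ioc] at hzero
    exact measure_eq_zero_iff_ae_notMem.1 hzero
  have hall : ∀ᵐ v ∂μ, ∀ q : ℚ, (q : ℝ) ∈ U → A q < B q → B v ∉ Ioc (A q) (B q) := by
    rw [ae_all_iff]
    intro q
    by_cases hq : (q : ℝ) ∈ U ∧ A q < B q
    · filter_upwards [hnull q hq.1 hq.2] with v hv _ _ using hv
    · exact Filter.Eventually.of_forall fun v h1 h2 => absurd ⟨h1, h2⟩ hq
  filter_upwards [hμ, hall] with v hv hq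
  by_contra! hlt
  -- If `A v < B v`, a rational `q` slightly above `v` still has `A q < B v`, which puts `B v` in
  -- one of the countably many null gaps.
  have hnhds : ∀ᶠ w in nhds v, w ∈ U ∧ A w < B v :=
    Filter.Eventually.and (hU.mem_nhds hv)
      ((hAc.continuousAt (hU.mem_nhds hv)).eventually_lt_const hlt)
  obtain ⟨ε, hε, hball⟩ := Metric.eventually_nhds_iff.1 hnhds
  obtain ⟨q, hvq, hqε⟩ := exists_rat_btwn (lt_add_of_pos_right v hε)
  obtain ⟨hqU, hqA⟩ := hball (y := q) (by
    rw [Real.dist_eq, abs_of_pos (by linarith)]; linarith)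
  have hBq : B v < B q := hBm hv hqU hvq
  exact hq q hqU (hqA.trans hBq) ⟨hqA, hBq.le⟩

theorem ae_eq_of_map_eq_of_strictMonoOn {μ : Measure ℝ} [IsFiniteMeasure μ] {U : Set ℝ}
    (hU : IsOpen U) (hμ : ∀ᵐ v ∂μ, v ∈ U) {A B : ℝ → ℝ} (hA : AEMeasurable A μ)
    (hB : AEMeasurable B μ) (hAm : StrictMonoOn A U) (hBm : StrictMonoOn B U)
    (hAc : ContinuousOn A U) (hBc : ContinuousOn B U) (h : μ.map A = μ.map B) : A =ᵐ[μ] B := by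
  filter_upwards [ae_le_of_map_eq_of_strictMonoOn hU hμ hA hB hAm hBm hAc h,
    ae_le_of_map_eq_of_strictMonoOn hU hμ hB hA hBm hAm hBc h.symm] with v h1 h2
  exact le_antisymm h2 h1

theorem ae_eq_of_map_eq_of_strictAntiOn {μ : Measure ℝ} [IsFiniteMeasure μ] {U : Set ℝ}
    (hU : IsOpen U) (hμ : ∀ᵐ v ∂μ, v ∈ U) {A B : ℝ → ℝ} (hA : AEMeasurable A μ)
    (hB : AEMeasurable B μ) (hAm : StrictAntiOn A U) (hBm : StrictAntiOn B U)
    (hAc : ContinuousOn A U) (hBc : ContinuousOn B U) (h : μ.map A = μ.map B) : A =ᵐ[μ] B := by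
  have hneg : μ.map (fun v => -A v) = μ.map (fun v => -B v) := by
    have hAn := AEMeasurable.map_map_of_aemeasurable measurable_neg.aemeasurable hA
    have hBn := AEMeasurable.map_map_of_aemeasurable measurable_neg.aemeasurable hB
    rw [h, hBn] at hAn
    exact hAn.symm
  have := ae_eq_of_map_eq_of_strictMonoOn hU hμ hA.neg hB.neg
    (fun a ha b hb hab => neg_lt_neg (hAm ha hb hab))
    (fun a ha b hb hab => neg_lt_neg (hBm ha hb hab)) hAc.neg hBc.neg hneg
  filter_upwards [this] with v hv
  exact neg_injective hv

/-- A measure on a standard Borel space is determined by its push-forward under a measurable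
function that is injective on a conull set. -/
theorem eq_of_map_eq_of_injOn {α β : Type*} [MeasurableSpace α] [StandardBorelSpace α]
    [MeasurableSpace β] [MeasurableSpace.CountablySeparated β] {μ ν : Measure α} {V : Set α}
    (hV : MeasurableSet V) (hμ : ∀ᵐ v ∂μ, v ∈ V) (hν : ∀ᵐ v ∂ν, v ∈ V) {g : α → β}
    (hg : Measurable g) (hinj : InjOn g V) (h : μ.map g = ν.map g) : μ = ν := by
  -- By Lusin–Souslin the injective image of `A ∩ V` is measurable, so its mass under the
  -- push-forward recovers `ρ A`.
  have key : ∀ (ρ : Measure α), (∀ᵐ v ∂ρ, v ∈ V) → ∀ A, MeasurableSet A →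
      ρ.map g (g '' (A ∩ V)) = ρ A := by
    intro ρ hρ A hA
    rw [Measure.map_apply hg ((hA.inter hV).image_of_measurable_injOn hg
      (hinj.mono inter_subset_right))]
    refine measure_congr (Filter.eventuallyEq_set.2 ?_)
    filter_upwards [hρ] with v hv
    refine ⟨?_, fun hvA => ⟨v, ⟨hvA, hv⟩, rfl⟩⟩
    rintro ⟨w, ⟨hwA, hwV⟩, hw⟩
    rwa [← hinj hwV hv hw]
  ext A hA
  rw [← key μ hμ A hA, ← key ν hν A hA, h]

end MeasureTheory

namespace ProbabilityTheory

/-- Independence under a product measure may be checked for each value of the second variable, if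
one of the two functions does not depend on that variable. -/
theorem indepFun_prod_of_forall {α γ β β' : Type*} [MeasurableSpace α] [MeasurableSpace γ]
    [MeasurableSpace β] [MeasurableSpace β'] {μ : Measure α} {ν : Measure γ}
    [IsProbabilityMeasure μ] [IsProbabilityMeasure ν] {F : α × γ → β} {g : α → β'}
    (hF : Measurable F) (hg : Measurable g)
    (h : ∀ z, IndepFun (fun u => F (u, z)) g μ) :
    IndepFun F (fun p => g p.1) (μ.prod ν) := by
  rw [indepFun_iff_measure_inter_preimage_eq_mul]
  intro s t hs ht
  have hgt : (μ.prod ν) ((fun p : α × γ => g p.1) ⁻¹' t) = μ (g ⁻¹' t) := by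
    have : (fun p : α × γ => g p.1) ⁻¹' t = (g ⁻¹' t) ×ˢ univ := by ext; simp
    rw [this, Measure.prod_prod, measure_univ, mul_one]
  have hgm : Measurable fun p : α × γ => g p.1 := hg.comp measurable_fst
  rw [hgt, Measure.prod_apply_symm ((hF hs).inter (hgm ht)), Measure.prod_apply_symm (hF hs),
    ← lintegral_mul_const _ (measurable_measure_prodMk_right (hF hs))]
  refine lintegral_congr fun z => ?_
  exact indepFun_iff_measure_inter_preimage_eq_mul.1 (h z) s t hs ht

end ProbabilityTheory

/-! ### Structural equations: locality, monotonicity, measurability. -/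

namespace SCM

variable {ι Z : Type*} [MeasurableSpace Z]

/-- Already true for every iterate of `step`: a parent of a non-descendant of `i` is again a
non-descendant. -/
theorem generate_congr_of_not_desc [Fintype ι] (M : SCM ι Z) {u u' : ι → ℝ} (hu : u ∈ M.box)
    (z : Z) {i j : ι} (h : ∀ k, k ≠ i → u k = u' k)
    (hj : ¬ Relation.ReflTransGen M.causalGraph.edge i j) :
    M.generate u z j = M.generate u' z j := by
  unfold generate
  generalize Fintype.card ι = n
  induction n generalizing j with
  | zero => rfl
  | succ n ih =>
    rw [Function.iterate_succ_apply', Function.iterate_succ_apply']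
    have hji : j ≠ i := by rintro rfl; exact hj Relation.ReflTransGen.refl
    change M.f j _ (u j) z = M.f j _ (u' j) z
    rw [← h j hji]
    exact M.f_congr (hu j (mem_univ j)) z fun k hk => ih fun hik => hj (hik.tail hk)

theorem not_desc_of_edge [Fintype ι] {M : SCM ι Z} (hM : M.causalGraph.Acyclic) {i k : ι}
    (hk : M.causalGraph.edge k i) : ¬ Relation.ReflTransGen M.causalGraph.edge i k := fun h =>
  hM i (Relation.TransGen.tail' h hk)

theorem f_eq_of_notMem_hiddenChildren (M : SCM ι Z) {i : ι}
    (hi : i ∉ M.causalGraph.hiddenChildren) (x : ι → ℝ) {v : ℝ} (hv : v ∈ M.U i) (z z' : Z) :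
    M.f i x v z = M.f i x v z' := by
  by_contra h
  exact hi ⟨x, v, hv, z, z', h⟩

theorem update_mem_box [DecidableEq ι] {M : SCM ι Z} {u : ι → ℝ} (hu : u ∈ M.box) {i : ι} {v : ℝ}
    (hv : v ∈ M.U i) : Function.update u i v ∈ M.box := by
  intro j _
  by_cases h : j = i
  · subst h; simpa using hv
  · simpa [h] using hu j (mem_univ j)

theorem generate_update_of_edge [Fintype ι] [DecidableEq ι] {M : SCM ι Z}
    (hM : M.causalGraph.Acyclic) {u : ι → ℝ} (hu : u ∈ M.box) (z : Z) {i k : ι} (v : ℝ)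
    (hk : M.causalGraph.edge k i) :
    M.generate (Function.update u i v) z k = M.generate u z k :=
  (M.generate_congr_of_not_desc hu z (i := i) (fun j hj => by simp [hj])
    (not_desc_of_edge hM hk)).symm

/-- Varying only `u i` leaves the parents fixed, so a mechanism is a coordinate of the
data-generating process along a line and inherits its regularity. -/
theorem f_generate_eq [Fintype ι] [DecidableEq ι] {M : SCM ι Z} (hM : M.causalGraph.Acyclic)
    {u : ι → ℝ} (hu : u ∈ M.box) (z : Z) {i : ι} {v : ℝ} (hv : v ∈ M.U i) :
    M.f i (M.generate u z) v z = M.generate (Function.update u i v) z i := by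
  rw [(M.eq_generate_iff hM (update_mem_box hu hv) z _).1 rfl i, Function.update_self]
  exact M.f_congr hv z fun j hj => (generate_update_of_edge hM hu z v hj).symm

theorem generate_eq_f [Fintype ι] {M : SCM ι Z} (hM : M.causalGraph.Acyclic)
    {u : ι → ℝ} (hu : u ∈ M.box) (z : Z) (i : ι) :
    M.generate u z i = M.f i (M.generate u z) (u i) z :=
  (M.eq_generate_iff hM hu z _).1 rfl i

namespace Admissible

variable [Fintype ι] {M : SCM ι Z} {X : Set (ι → ℝ)}

theorem exists_generate_eq (hM : M.Admissible X) (z : Z) {x : ι → ℝ} (hx : x ∈ X) :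
    ∃ u ∈ M.box, M.generate u z = x := by
  obtain ⟨-, -, -, -, R, hR, -, hinv⟩ := hM.diffeo z
  exact ⟨R x, hR hx, hinv.2 hx⟩

theorem generate_mem (hM : M.Admissible X) (z : Z) {u : ι → ℝ} (hu : u ∈ M.box) :
    M.generate u z ∈ X :=
  (hM.diffeo z).2.2.1 hu

theorem injOn_generate (hM : M.Admissible X) (z : Z) :
    InjOn (fun u => M.generate u z) M.box := by
  obtain ⟨-, -, -, -, R, hR, -, hinv⟩ := hM.diffeo z
  exact hinv.1.injOn

theorem contDiffOn_generate (hM : M.Admissible X) (z : Z) :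
    ContDiffOn ℝ 1 (fun u => M.generate u z) M.box :=
  (hM.diffeo z).2.2.2.1

/-- If `a` and `b` gave the same value, one vector would solve the structural equations for both
exogenous inputs, against injectivity of the data-generating process. -/
theorem injOn_f (hM : M.Admissible X) {x : ι → ℝ} (hx : x ∈ X) (i : ι) (z : Z) :
    InjOn (fun v => M.f i x v z) (M.U i) := by
  classical
  intro a ha b hb hab
  obtain ⟨u, hu, rfl⟩ := hM.exists_generate_eq z hx
  have hac := hM.acyclic
  set y := M.generate (Function.update u i a) z with hy
  have hya := (M.eq_generate_iff hac (update_mem_box hu ha) z y).1 rfl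
  have hpa : ∀ v ∈ M.U i, M.f i y v z = M.f i (M.generate u z) v z := fun v hv =>
    M.f_congr hv z fun k hk => generate_update_of_edge hac hu z a hk
  have hyb : y = M.generate (Function.update u i b) z := by
    rw [M.eq_generate_iff hac (update_mem_box hu hb)]
    intro j
    rw [hya j]
    by_cases hj : j = i
    · subst hj
      simp only [Function.update_self]
      rw [hpa a ha, hpa b hb]
      exact hab
    · simp [hj]
  have := hM.injOn_generate z (update_mem_box hu ha) (update_mem_box hu hb) hyb
  simpa using congrFun this i

theorem continuousOn_f (hM : M.Admissible X) {x : ι → ℝ} (hx : x ∈ X) (i : ι) (z : Z) :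
    ContinuousOn (fun v => M.f i x v z) (M.U i) := by
  classical
  obtain ⟨u, hu, rfl⟩ := hM.exists_generate_eq z hx
  have hup : Continuous fun v : ℝ => Function.update u i v := continuous_const.update i continuous_id
  have h : ContinuousOn (fun v => M.generate (Function.update u i v) z i) (M.U i) :=
    (continuous_apply i).comp_continuousOn ((hM.contDiffOn_generate z).continuousOn.comp
      hup.continuousOn fun v hv => update_mem_box hu hv)
  exact h.congr fun v hv => f_generate_eq hM.acyclic hu z hv

/-- The structural equations are strictly monotone in the exogenous variable, and the direction does
not depend on the parents. -/
theorem strictMonoOn_or_strictAntiOn_f (hM : M.Admissible X) (i : ι) (z : Z) :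
    (∀ x ∈ X, StrictMonoOn (fun v => M.f i x v z) (M.U i)) ∨
      ∀ x ∈ X, StrictAntiOn (fun v => M.f i x v z) (M.U i) := by
  classical
  -- Triples `(u, a, b)` with `a < b` form a convex set on which the increment `h` is continuous and
  -- never zero, so its sign is constant.
  let P : Set ((ι → ℝ) × ℝ × ℝ) :=
    {p | p.1 ∈ M.box ∧ p.2.1 ∈ M.U i ∧ p.2.2 ∈ M.U i ∧ p.2.1 < p.2.2}
  let h : (ι → ℝ) × ℝ × ℝ → ℝ := fun p =>
    M.generate (Function.update p.1 i p.2.2) z i - M.generate (Function.update p.1 i p.2.1) z i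
  have hP : IsPreconnected P := by
    refine Convex.isPreconnected ?_
    have hb : Convex ℝ M.box := convex_pi fun j _ => (hM.ordConnected_U j).convex
    have hU : Convex ℝ (M.U i) := (hM.ordConnected_U i).convex
    rintro ⟨u, a, b⟩ ⟨h1, h2, h3, h4⟩ ⟨u', a', b'⟩ ⟨h1', h2', h3', h4'⟩ s t hs ht hst
    refine ⟨hb h1 h1' hs ht hst, hU h2 h2' hs ht hst, hU h3 h3' hs ht hst, ?_⟩
    simp only [Prod.smul_mk, Prod.mk_add_mk, smul_eq_mul] at h4 h4' ⊢
    rcases hs.eq_or_lt with rfl | hs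
    · have : t = 1 := by linarith
      subst this; linarith
    · have := mul_lt_mul_of_pos_left h4 hs
      have := mul_le_mul_of_nonneg_left h4'.le ht
      linarith
  have hc : ContinuousOn h P := by
    have hg := (hM.contDiffOn_generate z).continuousOn
    have h2 : ContinuousOn (fun p : (ι → ℝ) × ℝ × ℝ =>
        M.generate (Function.update p.1 i p.2.2) z i) P :=
      (continuous_apply i).comp_continuousOn (hg.comp
        (continuous_fst.update i (continuous_snd.comp continuous_snd)).continuousOn
        fun p hp => update_mem_box hp.1 hp.2.2.1)
    have h1 : ContinuousOn (fun p : (ι → ℝ) × ℝ × ℝ =>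
        M.generate (Function.update p.1 i p.2.1) z i) P :=
      (continuous_apply i).comp_continuousOn (hg.comp
        (continuous_fst.update i (continuous_fst.comp continuous_snd)).continuousOn
        fun p hp => update_mem_box hp.1 hp.2.1)
    exact h2.sub h1
  have hf : ∀ p ∈ P, h p = M.f i (M.generate p.1 z) p.2.2 z - M.f i (M.generate p.1 z) p.2.1 z := by
    rintro p ⟨h1, h2, h3, -⟩
    rw [f_generate_eq hM.acyclic h1 z h2, f_generate_eq hM.acyclic h1 z h3]
  have hne : ∀ p ∈ P, h p ≠ 0 := by
    intro p hp h0
    rw [hf p hp, sub_eq_zero] at h0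
    exact hp.2.2.2.ne' (hM.injOn_f (hM.generate_mem z hp.1) i z hp.2.2.1 hp.2.1 h0)
  by_cases hneg : ∃ p ∈ P, h p < 0
  · right
    intro x hx a ha b hb hab
    obtain ⟨u, hu, rfl⟩ := hM.exists_generate_eq z hx
    obtain ⟨p, hp, hp0⟩ := hneg
    have hq : (u, a, b) ∈ P := ⟨hu, ha, hb, hab⟩
    have hlt : h (u, a, b) < 0 := by
      by_contra! hge
      obtain ⟨r, hr, hr0⟩ := hP.intermediate_value hp hq hc ⟨hp0.le, hge⟩
      exact hne r hr hr0
    rw [hf _ hq] at hlt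
    exact sub_neg.1 hlt
  · left
    intro x hx a ha b hb hab
    obtain ⟨u, hu, rfl⟩ := hM.exists_generate_eq z hx
    have hq : (u, a, b) ∈ P := ⟨hu, ha, hb, hab⟩
    have hlt : 0 < h (u, a, b) :=
      lt_of_le_of_ne (not_lt.1 fun hlt => hneg ⟨_, hq, hlt⟩) (hne _ hq).symm
    rw [hf _ hq] at hlt
    exact sub_pos.1 hlt

theorem f_lt_f_iff (hM : M.Admissible X) {x y : ι → ℝ} (hx : x ∈ X) (hy : y ∈ X) (i : ι) (z : Z)
    {a b : ℝ} (ha : a ∈ M.U i) (hb : b ∈ M.U i) :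
    M.f i x a z < M.f i x b z ↔ M.f i y a z < M.f i y b z := by
  rcases hM.strictMonoOn_or_strictAntiOn_f i z with h | h
  · exact ((h x hx).lt_iff_lt ha hb).trans ((h y hy).lt_iff_lt ha hb).symm
  · exact ((h x hx).lt_iff_gt ha hb).trans ((h y hy).lt_iff_gt ha hb).symm

theorem measurable_f_apply (hM : M.Admissible X) (i : ι) (z : Z) :
    Measurable fun p : (ι → ℝ) × ℝ => M.f i p.1 p.2 z :=
  (hM.measurable_f i).comp (measurable_fst.prodMk (measurable_snd.prodMk measurable_const))

theorem measurable_generate (hM : M.Admissible X) :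
    Measurable fun p : (ι → ℝ) × Z => M.generate p.1 p.2 := by
  unfold generate
  generalize Fintype.card ι = n
  induction n with
  | zero => exact measurable_const
  | succ n ih =>
    simp only [Function.iterate_succ_apply']
    refine measurable_pi_lambda _ fun i => ?_
    exact (hM.measurable_f i).comp (ih.prodMk
      (((measurable_pi_apply i).comp measurable_fst).prodMk measurable_snd))

theorem measurable_generate_left (hM : M.Admissible X) (z : Z) :
    Measurable fun u => M.generate u z :=
  hM.measurable_generate.comp measurable_prodMk_right

theorem ae_latent_mem_box (hM : M.Admissible X) : ∀ᵐ p ∂M.latentLaw, p.1 ∈ M.box :=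
  Measure.quasiMeasurePreserving_fst.ae hM.mem_box

theorem ae_mem_U (hM : M.Admissible X) (i : ι) : ∀ᵐ v ∂(M.Pu.map fun u => u i), v ∈ M.U i := by
  rw [ae_map_iff (f := fun u : ι → ℝ => u i) (p := fun v => v ∈ M.U i)
    (measurable_pi_apply i).aemeasurable (hM.isOpen_U i).measurableSet]
  filter_upwards [hM.mem_box] with u hu using hu i (mem_univ i)

theorem isProbabilityMeasure_obsLaw (hM : M.Admissible X) : IsProbabilityMeasure M.obsLaw :=
  Measure.isProbabilityMeasure_map hM.measurable_generate.aemeasurable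

theorem isOpen_range (hM : M.Admissible X) : IsOpen X :=
  (hM.diffeo (nonempty_of_isProbabilityMeasure M.Pz).some).2.1

theorem ae_obsLaw_mem (hM : M.Admissible X) : ∀ᵐ x ∂M.obsLaw, x ∈ X := by
  rw [obsLaw, ae_map_iff (p := fun x => x ∈ X) hM.measurable_generate.aemeasurable
    hM.isOpen_range.measurableSet]
  filter_upwards [hM.ae_latent_mem_box] with p hp using hM.generate_mem p.2 hp

/-- For each `z`, the inverse process is `C¹` and so sends null sets to null sets; integrate over
`z`. -/
theorem obsLaw_absolutelyContinuous (hM : M.Admissible X) : M.obsLaw ≪ volume := by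
  refine Measure.AbsolutelyContinuous.mk fun s hs hs0 => ?_
  rw [obsLaw, Measure.map_apply hM.measurable_generate hs, latentLaw,
    Measure.prod_apply_symm (hM.measurable_generate hs)]
  refine lintegral_eq_zero_of_ae_eq_zero (Filter.Eventually.of_forall fun z => ?_)
  obtain ⟨-, -, hmaps, -, R, -, hR, hinv⟩ := hM.diffeo z
  have hnull : volume (R '' (s ∩ X)) = 0 :=
    addHaar_image_eq_zero_of_differentiableOn_of_addHaar_eq_zero volume
      ((hR.differentiableOn one_ne_zero).mono inter_subset_right)
      (measure_mono_null inter_subset_left hs0)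
  refine measure_mono_null_ae ?_ (hM.continuous_law hnull)
  filter_upwards [hM.mem_box] with u hu hus
  exact ⟨_, ⟨hus, hmaps hu⟩, hinv.1 hu⟩

end Admissible

/-! ### Parents, conditional laws and recovery of the exogenous variables. -/

theorem map_fst_latentLaw (M : SCM ι Z) : M.latentLaw.map Prod.fst = M.Pu := by
  rw [latentLaw, Measure.map_fst_prod, measure_univ, one_smul]

open Classical in
/-- The vector `x` with all entries other than the causal parents of `i` replaced by zero. -/
noncomputable def parentPart (M : SCM ι Z) (i : ι) (x : ι → ℝ) : ι → ℝ :=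
  fun k => if M.causalGraph.edge k i then x k else 0

theorem measurable_parentPart (M : SCM ι Z) (i : ι) : Measurable (M.parentPart i) := by
  refine measurable_pi_lambda _ fun k => ?_
  by_cases h : M.causalGraph.edge k i
  · simpa [parentPart, h] using measurable_pi_apply k
  · simp [parentPart, h]

theorem parentPart_congr (M : SCM ι Z) {i : ι} {x y : ι → ℝ}
    (h : ∀ k, M.causalGraph.edge k i → x k = y k) : M.parentPart i x = M.parentPart i y := by
  funext k
  by_cases hk : M.causalGraph.edge k i
  · simp [parentPart, hk, h k hk]
  · simp [parentPart, hk]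

theorem parentPart_eq {Z' : Type*} [MeasurableSpace Z'] {M : SCM ι Z} {N : SCM ι Z'}
    (hgraph : M.causalGraph = N.causalGraph) (i : ι) :
    M.parentPart i = N.parentPart i := by
  unfold parentPart
  rw [hgraph]

theorem f_parentPart [Finite ι] (M : SCM ι Z) {i : ι} (x : ι → ℝ) {v : ℝ} (hv : v ∈ M.U i)
    (z : Z) : M.f i (M.parentPart i x) v z = M.f i x v z :=
  M.f_congr hv z fun k hk => by simp [parentPart, hk]

namespace Admissible

variable [Fintype ι] {M : SCM ι Z} {X : Set (ι → ℝ)}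

/-- The causal parents of `x i` are independent of `u i`. -/
theorem indepFun_parentPart (hM : M.Admissible X) (i : ι) :
    IndepFun (fun p : (ι → ℝ) × Z => M.parentPart i (M.generate p.1 p.2)) (fun p => p.1 i)
      M.latentLaw := by
  classical
  refine indepFun_prod_of_forall (F := fun p => M.parentPart i (M.generate p.1 p.2))
    (g := fun u : ι → ℝ => u i) ((M.measurable_parentPart i).comp hM.measurable_generate)
    (measurable_pi_apply i) fun z => ?_
  have hm : ∀ j : ι, Measurable fun u : ι → ℝ => u j := measurable_pi_apply
  obtain ⟨u₀, hu₀⟩ := hM.mem_box.exists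
  -- Entry `i` is filled with the fixed value `u₀ i`; the parents do not notice, so they become a
  -- function of the other entries.
  let e : (({i}ᶜ : Finset ι) → ℝ) → ι → ℝ := fun w j =>
    if h : j ∈ ({i}ᶜ : Finset ι) then w ⟨j, h⟩ else u₀ i
  have he : Measurable e := by
    refine measurable_pi_lambda _ fun j => ?_
    by_cases h : j ∈ ({i}ᶜ : Finset ι)
    · simpa only [e, h, dite_true] using measurable_pi_apply (⟨j, h⟩ : ({i}ᶜ : Finset ι))
    · simp only [e, h, dite_false, measurable_const]
  have hev : Measurable fun w : ({i} : Finset ι) → ℝ => w ⟨i, Finset.mem_singleton_self i⟩ :=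
    measurable_pi_apply _
  have hind := (hM.indep.indepFun_finset ({i}ᶜ) {i} disjoint_compl_left hm).comp
    (φ := fun w => M.parentPart i (M.generate (e w) z))
    (ψ := fun w : ({i} : Finset ι) → ℝ => w ⟨i, Finset.mem_singleton_self i⟩)
    ((M.measurable_parentPart i).comp ((hM.measurable_generate_left z).comp he))
    hev
  refine hind.congr ?_ (Filter.EventuallyEq.refl _ _)
  filter_upwards [hM.mem_box] with u hu
  have heu : e (fun j => u j) = Function.update u i (u₀ i) := by
    funext j
    by_cases h : j = i
    · subst h; simp [e]
    · simp [e, h]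
  simp only [Function.comp_apply]
  rw [heu]
  exact M.parentPart_congr fun k hk => generate_update_of_edge hM.acyclic hu z (u₀ i) hk

theorem map_parentPart_exo (hM : M.Admissible X) (i : ι) :
    M.latentLaw.map (fun p => (M.parentPart i (M.generate p.1 p.2), p.1 i)) =
      (M.obsLaw.map (M.parentPart i)).prod (M.Pu.map fun u => u i) := by
  have h1 : Measurable fun p : (ι → ℝ) × Z => M.parentPart i (M.generate p.1 p.2) :=
    (M.measurable_parentPart i).comp hM.measurable_generate
  have h2 : Measurable fun p : (ι → ℝ) × Z => p.1 i := (measurable_pi_apply i).comp measurable_fst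
  rw [(indepFun_iff_map_prod_eq_prod_map_map h1.aemeasurable h2.aemeasurable).1
    (hM.indepFun_parentPart i), obsLaw,
    Measure.map_map (M.measurable_parentPart i) hM.measurable_generate]
  congr 1
  rw [← M.map_fst_latentLaw, Measure.map_map (measurable_pi_apply i) measurable_fst]
  rfl

/-- The law of `f i x v z` for given `x` and `z` and random `v`, as a kernel in `x`. -/
noncomputable def mechKernel (M : SCM ι Z) (i : ι) (z : Z) : Kernel (ι → ℝ) ℝ :=
  (Kernel.id ×ₖ Kernel.const (ι → ℝ) (M.Pu.map fun u => u i)).map fun p => M.f i p.1 p.2 z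

theorem mechKernel_apply (hM : M.Admissible X) (i : ι) (z : Z) (x : ι → ℝ) :
    mechKernel M i z x = (M.Pu.map fun u => u i).map fun v => M.f i x v z := by
  have := Measure.isProbabilityMeasure_map (μ := M.Pu) (measurable_pi_apply i).aemeasurable
  rw [mechKernel, Kernel.map_apply _ (hM.measurable_f_apply i z), Kernel.prod_apply,
    Kernel.id_apply, Kernel.const_apply, Measure.dirac_prod,
    Measure.map_map (hM.measurable_f_apply i z) measurable_prodMk_left]
  rfl

theorem isMarkovKernel_mechKernel (hM : M.Admissible X) (i : ι) (z : Z) :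
    IsMarkovKernel (mechKernel M i z) := by
  have := Measure.isProbabilityMeasure_map (μ := M.Pu) (measurable_pi_apply i).aemeasurable
  exact Kernel.IsMarkovKernel.map _ (hM.measurable_f_apply i z)

/-- Identifies `mechKernel` as the conditional law of `x i` given its parents, through their
independence from `u i`. -/
theorem compProd_mechKernel (hM : M.Admissible X) {i : ι}
    (hi : i ∉ M.causalGraph.hiddenChildren) (z : Z) :
    (M.obsLaw.map (M.parentPart i)) ⊗ₘ mechKernel M i z =
      M.obsLaw.map fun x => (M.parentPart i x, x i) := by
  have := Measure.isProbabilityMeasure_map (μ := M.Pu) (measurable_pi_apply i).aemeasurable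
  have := hM.isProbabilityMeasure_obsLaw
  have := Measure.isProbabilityMeasure_map (μ := M.obsLaw)
    (M.measurable_parentPart i).aemeasurable
  have := hM.isMarkovKernel_mechKernel i z
  have hG : Measurable fun p : (ι → ℝ) × ℝ => (p.1, M.f i p.1 p.2 z) :=
    measurable_fst.prodMk (hM.measurable_f_apply i z)
  have h1 : (M.obsLaw.map (M.parentPart i)) ⊗ₘ mechKernel M i z =
      ((M.obsLaw.map (M.parentPart i)).prod (M.Pu.map fun u => u i)).map
        fun p => (p.1, M.f i p.1 p.2 z) := by
    ext s hs
    rw [Measure.compProd_apply hs, Measure.map_apply hG hs, Measure.prod_apply (hG hs)]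
    refine lintegral_congr fun y => ?_
    have hy : Measurable fun v => M.f i y v z :=
      (hM.measurable_f_apply i z).comp measurable_prodMk_left
    rw [hM.mechKernel_apply, Measure.map_apply hy (measurable_prodMk_left hs)]
    rfl
  have hgen := hM.measurable_generate
  have hpar := M.measurable_parentPart i
  have hpair : Measurable fun p : (ι → ℝ) × Z =>
      (M.parentPart i (M.generate p.1 p.2), p.1 i) :=
    (hpar.comp hgen).prodMk ((measurable_pi_apply i).comp measurable_fst)
  rw [h1, ← hM.map_parentPart_exo i, Measure.map_map hG hpair, obsLaw,
    Measure.map_map (hpar.prodMk (measurable_pi_apply i)) hgen]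
  refine Measure.map_congr ?_
  filter_upwards [hM.ae_latent_mem_box] with p hp
  have hv := hp i (mem_univ i)
  simp only [Function.comp_apply]
  rw [M.f_parentPart _ hv, M.f_eq_of_notMem_hiddenChildren hi _ hv z p.2,
    ← generate_eq_f hM.acyclic hp]

/-- The exogenous variables outside the children of `z` are functions of the observed vector. -/
theorem exists_exo_recovery (hM : M.Admissible X) (S : Set ι)
    (hS : M.causalGraph.hiddenChildren ⊆ S) :
    ∃ H : (ι → ℝ) → ({i // i ∉ S} → ℝ), Measurable H ∧
      ∀ u ∈ M.box, ∀ z, ∀ i, H (M.generate u z) i = u i := by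
  classical
  have z₀ := (nonempty_of_isProbabilityMeasure M.Pz).some
  obtain ⟨-, hX, -, -, R, hR, hRc, hinv⟩ := hM.diffeo z₀
  have hRm : Measurable (X.piecewise R 0) :=
    hRc.continuousOn.measurable_piecewise_zero hX.measurableSet
  -- Inverting at `z₀` instead of the true `z` is harmless outside `S`: there the mechanism ignores
  -- the confounder and is injective in the exogenous variable.
  refine ⟨fun x i => X.piecewise R 0 x i, measurable_pi_lambda _ fun i =>
    (measurable_pi_apply _).comp hRm, fun u hu z i => ?_⟩
  have hx := hM.generate_mem z hu
  have hRx := hR hx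
  have h1 := generate_eq_f hM.acyclic hRx z₀ i
  have h2 := generate_eq_f hM.acyclic hu z i
  rw [show M.generate (R (M.generate u z)) z₀ = M.generate u z from hinv.2 hx, h2,
    M.f_eq_of_notMem_hiddenChildren (fun h => i.2 (hS h)) _ (hu i (mem_univ _)) z z₀] at h1
  simp only [piecewise_eq_of_mem _ _ _ hx]
  exact (hM.injOn_f hx i z₀ (hu i (mem_univ _)) (hRx i (mem_univ _)) h1).symm

/-! ### Comparison of two models. -/

variable {Z' : Type*} [MeasurableSpace Z'] {N : SCM ι Z'}

theorem obsLaw_eq (hM : M.Admissible X) (hN : N.Admissible X)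
    (hobs : M.obsDensity =ᵐ[volume] N.obsDensity) : M.obsLaw = N.obsLaw := by
  have := hM.isProbabilityMeasure_obsLaw
  have := hN.isProbabilityMeasure_obsLaw
  rw [← Measure.withDensity_rnDeriv_eq _ _ hM.obsLaw_absolutelyContinuous,
    ← Measure.withDensity_rnDeriv_eq _ _ hN.obsLaw_absolutelyContinuous]
  exact withDensity_congr_ae hobs

/-- Observationally equivalent models have the same conditional law of `x i` given its causal
parents. -/
theorem ae_map_f_eq (hM : M.Admissible X) (hN : N.Admissible X)
    (hgraph : M.causalGraph = N.causalGraph) (hlaw : M.obsLaw = N.obsLaw) {i : ι}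
    (hi : i ∉ M.causalGraph.hiddenChildren) (z : Z) (z' : Z') :
    ∀ᵐ x ∂M.obsLaw, (M.Pu.map fun u => u i).map (fun v => M.f i x v z) =
      (N.Pu.map fun u => u i).map fun v => N.f i x v z' := by
  have := hM.isProbabilityMeasure_obsLaw
  have := Measure.isProbabilityMeasure_map (μ := M.obsLaw)
    (M.measurable_parentPart i).aemeasurable
  have := hM.isMarkovKernel_mechKernel i z
  have := hN.isMarkovKernel_mechKernel i z'
  have hM' := hM.compProd_mechKernel hi z
  have hN' := hN.compProd_mechKernel (hgraph ▸ hi) z'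
  rw [← hlaw, ← parentPart_eq hgraph, ← hM'] at hN'
  have hae := Kernel.ae_eq_of_compProd_eq hN'
  filter_upwards [ae_of_ae_map (M.measurable_parentPart i).aemeasurable hae] with x hx
  rw [hM.mechKernel_apply, hN.mechKernel_apply] at hx
  have h1 : (M.Pu.map fun u => u i).map (fun v => M.f i (M.parentPart i x) v z) =
      (M.Pu.map fun u => u i).map (fun v => M.f i x v z) := by
    refine Measure.map_congr ?_
    filter_upwards [hM.ae_mem_U i] with v hv using M.f_parentPart x hv z
  have h2 : (N.Pu.map fun u => u i).map (fun v => N.f i (M.parentPart i x) v z') =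
      (N.Pu.map fun u => u i).map (fun v => N.f i x v z') := by
    rw [parentPart_eq hgraph]
    refine Measure.map_congr ?_
    filter_upwards [hN.ae_mem_U i] with v hv using N.f_parentPart x hv z'
  rw [← h1, ← h2, hx]

/-- For a given value of the observed vector, the exogenous variables of two models with the same
range are smooth functions of one another. -/
theorem exists_exo_transform (hM : M.Admissible X) (hN : N.Admissible X)
    (hgraph : M.causalGraph = N.causalGraph) {x : ι → ℝ} (hx : x ∈ X) (i : ι) (z : Z) (z' : Z') :
    ∃ T : ℝ → ℝ, MapsTo T (M.U i) (N.U i) ∧ ContDiffOn ℝ 1 T (M.U i) ∧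
      ∀ v ∈ M.U i, N.f i x (T v) z' = M.f i x v z := by
  classical
  obtain ⟨u, hu, rfl⟩ := hM.exists_generate_eq z hx
  obtain ⟨-, -, -, -, R, hR, hRc, hinv⟩ := hN.diffeo z'
  have hg : MapsTo (fun v => M.generate (Function.update u i v) z) (M.U i) X := fun v hv =>
    hM.generate_mem z (update_mem_box hu hv)
  -- Set the `i`th exogenous entry to `v`, generate with `M`, invert with `N`, and read off entry
  -- `i`.
  refine ⟨fun v => R (M.generate (Function.update u i v) z) i,
    fun v hv => hR (hg hv) i (mem_univ i), ?_, fun v hv => ?_⟩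
  · have hup : ContDiff ℝ 1 fun v : ℝ => Function.update u i v := contDiff_update 1 u i
    have := hRc.comp ((hM.contDiffOn_generate z).comp hup.contDiffOn
      fun v hv => update_mem_box hu hv) hg
    exact (contDiff_apply ℝ ℝ i).comp_contDiffOn this
  · set y := M.generate (Function.update u i v) z with hy
    have hRy : R y ∈ N.box := hR (hg hv)
    have hgen : N.generate (R y) z' = y := hinv.2 (hg hv)
    have h1 := generate_eq_f hN.acyclic hRy z' i
    rw [hgen] at h1
    rw [f_generate_eq hM.acyclic hu z hv, ← hy, h1]
    refine N.f_congr (hRy i (mem_univ i)) z' fun k hk => ?_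
    rw [← hgraph] at hk
    exact (generate_update_of_edge hM.acyclic hu z v hk).symm

/-- The element-wise transformation of one exogenous variable. -/
theorem exists_isC1Diffeo_mechanism (hM : M.Admissible X) (hN : N.Admissible X)
    (hgraph : M.causalGraph = N.causalGraph) (hlaw : M.obsLaw = N.obsLaw) {i : ι}
    (hi : i ∉ M.causalGraph.hiddenChildren) (z : Z) (z' : Z') :
    ∃ T : ℝ → ℝ, Measurable T ∧ IsC1Diffeo T (M.U i) (N.U i) ∧
      ∀ᵐ x ∂M.obsLaw, ∀ᵐ v ∂(M.Pu.map fun u => u i), M.f i x v z = N.f i x (T v) z' := by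
  classical
  have := Measure.isProbabilityMeasure_map (μ := M.Pu) (measurable_pi_apply i).aemeasurable
  have := hM.isProbabilityMeasure_obsLaw
  have hae := hM.ae_map_f_eq hN hgraph hlaw hi z z'
  obtain ⟨x₀, hx₀, hlaw₀⟩ := (hM.ae_obsLaw_mem.and hae).exists
  obtain ⟨T₀, hT₀, hT₀c, hT₀f⟩ := hM.exists_exo_transform hN hgraph hx₀ i z z'
  obtain ⟨R, hR, hRc, hRf⟩ := hN.exists_exo_transform hM hgraph.symm hx₀ i z' z
  -- The value `0` off `U i` only serves global measurability.
  let T : ℝ → ℝ := (M.U i).piecewise T₀ 0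
  have hTeq : EqOn T T₀ (M.U i) := piecewise_eqOn _ _ _
  have hTm : Measurable T :=
    hT₀c.continuousOn.measurable_piecewise_zero (hM.isOpen_U i).measurableSet
  have hTU : MapsTo T (M.U i) (N.U i) := hT₀.congr hTeq.symm
  have hTc : ContDiffOn ℝ 1 T (M.U i) := hT₀c.congr hTeq
  have hTf : ∀ v ∈ M.U i, N.f i x₀ (T v) z' = M.f i x₀ v z := fun v hv => by
    rw [hTeq hv, hT₀f v hv]
  have hfm : ∀ x, Measurable fun v => M.f i x v z := fun x =>
    (hM.measurable_f_apply i z).comp measurable_prodMk_left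
  have hfm' : ∀ x, Measurable fun v => N.f i x v z' := fun x =>
    (hN.measurable_f_apply i z').comp measurable_prodMk_left
  refine ⟨T, hTm, ⟨hM.isOpen_U i, hN.isOpen_U i, hTU, hTc, R, hR, hRc, ?_, ?_⟩, ?_⟩
  · intro v hv
    exact hM.injOn_f hx₀ i z (hR (hTU hv)) hv ((hRf _ (hTU hv)).trans (hTf v hv))
  · intro w hw
    exact hN.injOn_f hx₀ i z' (hTU (hR hw)) hw ((hTf _ (hR hw)).trans (hRf w hw))
  -- At `x₀` both sides have the same image under the injective mechanism of `N`.
  have hmap : (M.Pu.map fun u => u i).map T = N.Pu.map fun u => u i := by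
    refine eq_of_map_eq_of_injOn (hN.isOpen_U i).measurableSet ?_ (hN.ae_mem_U i) (hfm' x₀)
      (hN.injOn_f hx₀ i z') ?_
    · rw [ae_map_iff (p := fun v => v ∈ N.U i) hTm.aemeasurable (hN.isOpen_U i).measurableSet]
      filter_upwards [hM.ae_mem_U i] with v hv using hTU hv
    · rw [← hlaw₀, Measure.map_map (hfm' x₀) hTm]
      refine Measure.map_congr ?_
      filter_upwards [hM.ae_mem_U i] with v hv using hTf v hv
  filter_upwards [hM.ae_obsLaw_mem, hae] with x hx hxlaw
  -- Directions are constant in the parents, so the comparison can be made at `x₀`, where the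
  -- mechanisms match exactly.
  have hlt : ∀ a ∈ M.U i, ∀ b ∈ M.U i,
      (N.f i x (T a) z' < N.f i x (T b) z' ↔ M.f i x a z < M.f i x b z) := by
    intro a ha b hb
    rw [hN.f_lt_f_iff hx hx₀ i z' (hTU ha) (hTU hb), hTf a ha, hTf b hb,
      hM.f_lt_f_iff hx₀ hx i z ha hb]
  have hmaps : (M.Pu.map fun u => u i).map (fun v => M.f i x v z) =
      (M.Pu.map fun u => u i).map (fun v => N.f i x (T v) z') := by
    rw [hxlaw, ← hmap, Measure.map_map (hfm' x) hTm]
    rfl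
  have hc : ContinuousOn (fun v => N.f i x (T v) z') (M.U i) :=
    (hN.continuousOn_f hx i z').comp hTc.continuousOn hTU
  rcases hM.strictMonoOn_or_strictAntiOn_f i z with h | h
  · exact ae_eq_of_map_eq_of_strictMonoOn (hM.isOpen_U i) (hM.ae_mem_U i) (hfm x).aemeasurable
      ((hfm' x).comp hTm).aemeasurable (h x hx)
      (fun a ha b hb hab => (hlt a ha b hb).2 (h x hx ha hb hab)) (hM.continuousOn_f hx i z) hc
      hmaps
  · exact ae_eq_of_map_eq_of_strictAntiOn (hM.isOpen_U i) (hM.ae_mem_U i) (hfm x).aemeasurable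
      ((hfm' x).comp hTm).aemeasurable (h x hx)
      (fun a ha b hb hab => (hlt b hb a ha).2 (h x hx ha hb hab)) (hM.continuousOn_f hx i z) hc
      hmaps

/-- If the mechanisms agree almost everywhere after the transformation `T`, then `T` maps the
exogenous variable of one model to that of the other almost surely. -/
theorem ae_transform_eq (hM : M.Admissible X) (hN : N.Admissible X)
    (hgraph : M.causalGraph = N.causalGraph) {i : ι}
    (hi : i ∉ M.causalGraph.hiddenChildren) (z : Z) (z' : Z') {T : ℝ → ℝ} (hT : Measurable T)
    (hTU : MapsTo T (M.U i) (N.U i))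
    (hmech : ∀ᵐ x ∂M.obsLaw, ∀ᵐ v ∂(M.Pu.map fun u => u i), M.f i x v z = N.f i x (T v) z') :
    ∀ᵐ p ∂M.latentLaw, ∀ w ∈ N.box, N.generate w z' = M.generate p.1 p.2 → T (p.1 i) = w i := by
  have := Measure.isProbabilityMeasure_map (μ := M.Pu) (measurable_pi_apply i).aemeasurable
  let E : Set ((ι → ℝ) × ℝ) := {q | M.f i q.1 q.2 z = N.f i q.1 (T q.2) z'}
  have hE : MeasurableSet E := measurableSet_eq_fun (hM.measurable_f_apply i z)
    ((hN.measurable_f_apply i z').comp (measurable_fst.prodMk (hT.comp measurable_snd)))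
  have hpar := M.measurable_parentPart i
  -- By Fubini agreement holds for the product law, which by independence is the joint law of the
  -- parents and `u i`.
  have hprod : ∀ᵐ q ∂(M.obsLaw.map (M.parentPart i)).prod (M.Pu.map fun u => u i), q ∈ E := by
    rw [Measure.ae_prod_mem_iff_ae_ae_mem hE, ae_map_iff hpar.aemeasurable]
    · filter_upwards [hmech] with x hx
      filter_upwards [hx, hM.ae_mem_U i] with v hv hvU
      change M.f i _ v z = N.f i _ (T v) z'
      rw [M.f_parentPart x hvU, parentPart_eq hgraph, N.f_parentPart x (hTU hvU), hv]
    · exact measurable_measure_prodMk_left hE.compl (measurableSet_singleton 0)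
  rw [← hM.map_parentPart_exo i] at hprod
  have hpair : Measurable fun p : (ι → ℝ) × Z =>
      (M.parentPart i (M.generate p.1 p.2), p.1 i) :=
    (hpar.comp hM.measurable_generate).prodMk ((measurable_pi_apply i).comp measurable_fst)
  filter_upwards [ae_of_ae_map hpair.aemeasurable hprod, hM.ae_latent_mem_box] with p hpE hp w hw hwp
  have hv := hp i (mem_univ i)
  change M.f i (M.parentPart i _) (p.1 i) z = N.f i (M.parentPart i _) (T (p.1 i)) z' at hpE
  rw [M.f_parentPart _ hv, parentPart_eq hgraph, N.f_parentPart _ (hTU hv),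
    M.f_eq_of_notMem_hiddenChildren hi _ hv z p.2, ← generate_eq_f hM.acyclic hp, ← hwp,
    generate_eq_f hN.acyclic hw] at hpE
  -- Both `T (p.1 i)` and `w i` now produce the same `x i` through the mechanism of `N`.
  exact (hN.injOn_f (hN.generate_mem z' hw) i z' (hw i (mem_univ i)) (hTU hv) hpE).symm

end Admissible
end SCM

/-! ### Assembling the element-wise transformation. -/

theorem mainTheorem6 {ι Z Z' : Type*} [Fintype ι] [MeasurableSpace Z] [MeasurableSpace Z']
    (X : Set (ι → ℝ)) (M : SCM ι Z) (N : SCM ι Z')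
    (hM : M.Admissible X) (hN : N.Admissible X)
    (hgraph : M.causalGraph = N.causalGraph)
    (hobs : M.obsDensity =ᵐ[MeasureTheory.volume] N.obsDensity) :
    ∃ T : {i // i ∉ M.causalGraph.hiddenChildren} → ℝ → ℝ,
      M.EqOutsideUpTo N M.causalGraph.hiddenChildren T := by
  classical
  have hlaw := hM.obsLaw_eq hN hobs
  -- One confounder value per model suffices, since the mechanisms outside `ch(z)` ignore it.
  obtain ⟨z⟩ := nonempty_of_isProbabilityMeasure M.Pz
  obtain ⟨z'⟩ := nonempty_of_isProbabilityMeasure N.Pz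
  choose T hTm hTd hTf using fun i : {i // i ∉ M.causalGraph.hiddenChildren} =>
    hM.exists_isC1Diffeo_mechanism hN hgraph hlaw i.2 z z'
  obtain ⟨H, hHm, hH⟩ := hN.exists_exo_recovery M.causalGraph.hiddenChildren (by rw [hgraph])
  have hTmeas : Measurable fun (w : {i // i ∉ M.causalGraph.hiddenChildren} → ℝ) i => T i (w i) :=
    measurable_pi_lambda _ fun i => (hTm i).comp (measurable_pi_apply i)
  have hproj : Measurable fun (u : ι → ℝ) (i : {i // i ∉ M.causalGraph.hiddenChildren}) => u i :=
    measurable_pi_lambda _ fun i => measurable_pi_apply _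
  have hrestr : Measurable fun (x : ι → ℝ) (i : M.causalGraph.hiddenChildren) => x i :=
    measurable_pi_lambda _ fun i => measurable_pi_apply _
  have hTH : ∀ᵐ p ∂M.latentLaw, (fun i : {i // i ∉ M.causalGraph.hiddenChildren} =>
      T i (p.1 i)) = H (M.generate p.1 p.2) := by
    have hall := ae_all_iff.2 fun i => hM.ae_transform_eq hN hgraph i.2 z z' (hTm i)
      (hTd i).2.2.1 (hTf i)
    filter_upwards [hall, hM.ae_latent_mem_box] with p hp hbox
    obtain ⟨w, hw, hwp⟩ := hN.exists_generate_eq z' (hM.generate_mem p.2 hbox)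
    funext i
    rw [hp i w hw hwp, ← hwp, hH w hw z' i]
  have hNH : ∀ᵐ p ∂N.latentLaw, (fun i : {i // i ∉ M.causalGraph.hiddenChildren} =>
      p.1 i) = H (N.generate p.1 p.2) := by
    filter_upwards [hN.ae_latent_mem_box] with p hp
    funext i
    rw [hH _ hp]
  -- The pair `(x_S, T(u))` has the same law in both models.
  let J : (ι → ℝ) → (M.causalGraph.hiddenChildren → ℝ) ×
      ({i // i ∉ M.causalGraph.hiddenChildren} → ℝ) := fun x => (fun i => x i, H x)
  have hJ : Measurable J := hrestr.prodMk hHm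
  have hjM : M.latentLaw.map (fun p => ((fun i : M.causalGraph.hiddenChildren =>
      M.generate p.1 p.2 i), fun i : {i // i ∉ M.causalGraph.hiddenChildren} => T i (p.1 i))) =
      M.obsLaw.map J := by
    rw [SCM.obsLaw, Measure.map_map hJ hM.measurable_generate]
    refine Measure.map_congr ?_
    filter_upwards [hTH] with p hp
    rw [hp]; rfl
  have hjN : N.latentLaw.map (fun p => ((fun i : M.causalGraph.hiddenChildren =>
      N.generate p.1 p.2 i), fun i : {i // i ∉ M.causalGraph.hiddenChildren} => p.1 i)) =
      N.obsLaw.map J := by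
    rw [SCM.obsLaw, Measure.map_map hJ hN.measurable_generate]
    refine Measure.map_congr ?_
    filter_upwards [hNH] with p hp
    rw [hp]; rfl
  have hjoint := hjM.trans ((congrArg (Measure.map J) hlaw).trans hjN.symm)
  refine ⟨T, hTd, ?_, ?_, fun i => ?_⟩
  · have hpM : Measurable fun p : (ι → ℝ) × Z => ((fun i : M.causalGraph.hiddenChildren =>
        M.generate p.1 p.2 i), fun i : {i // i ∉ M.causalGraph.hiddenChildren} => T i (p.1 i)) :=
      (hrestr.comp hM.measurable_generate).prodMk (hTmeas.comp (hproj.comp measurable_fst))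
    have hpN : Measurable fun p : (ι → ℝ) × Z' => ((fun i : M.causalGraph.hiddenChildren =>
        N.generate p.1 p.2 i), fun i : {i // i ∉ M.causalGraph.hiddenChildren} => p.1 i) :=
      (hrestr.comp hN.measurable_generate).prodMk (hproj.comp measurable_fst)
    have hsnd := congrArg (Measure.map Prod.snd) hjoint
    rw [Measure.map_map measurable_snd hpM, Measure.map_map measurable_snd hpN] at hsnd
    rw [SCM.exoLaw, SCM.exoLaw, ← M.map_fst_latentLaw, ← N.map_fst_latentLaw,
      Measure.map_map hproj measurable_fst,
      Measure.map_map hproj measurable_fst, Measure.map_map hTmeas (hproj.comp measurable_fst)]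
    exact hsnd
  · have hcomp := condDistrib_comp (μ := M.latentLaw) (mβ := MeasurableSpace.pi)
      (fun p (i : M.causalGraph.hiddenChildren) => M.generate p.1 p.2 i)
      (hproj.comp measurable_fst).aemeasurable hTmeas
    have hcond : condDistrib ((fun (w : {i // i ∉ M.causalGraph.hiddenChildren} → ℝ) i =>
          T i (w i)) ∘ ((fun (u : ι → ℝ) (i : {i // i ∉ M.causalGraph.hiddenChildren}) => u i) ∘
            Prod.fst)) (fun p (i : M.causalGraph.hiddenChildren) => M.generate p.1 p.2 i)
          M.latentLaw =
        condDistrib (fun (p : (ι → ℝ) × Z') (i : {i // i ∉ M.causalGraph.hiddenChildren}) => p.1 i)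
          (fun p (i : M.causalGraph.hiddenChildren) => N.generate p.1 p.2 i) N.latentLaw := by
      -- A conditional distribution is the disintegration kernel of the joint law, so `hjoint` is
      -- enough.
      rw [condDistrib, condDistrib]
      congr 1
    rw [hcond] at hcomp
    rw [SCM.obsLaw, Measure.map_map hrestr hM.measurable_generate]
    filter_upwards [hcomp] with c hc
    rw [Kernel.map_apply _ hTmeas] at hc
    exact hc.symm
  · filter_upwards [hTf i] with x hx
    filter_upwards [hx, hM.ae_mem_U i] with v hv hvU y y'
    rw [M.f_eq_of_notMem_hiddenChildren i.2 x hvU y z, hv]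
    exact N.f_eq_of_notMem_hiddenChildren (hgraph ▸ i.2) x ((hTd i).2.2.1 hvU) z' y'
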